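/- Let $T>0$, $d,m,l\in\mathbb N$, $q\in[1,\infty]$, $J=\{1,\dots,l\}$. Let $f\colon\mathbb R^d\times\mathbb R^m\times[0,T]\to\mathbb R^d$, $\theta\colon\mathbb R^d\times[0,T]\to\mathbb R$, $\zeta\colon\mathbb R^d\to\mathbb R$, $g_j\colon\mathbb R^d\times[0,T]\to\mathbb R$ ($j\in J$) be given functions, $x_0\in\mathbb R^d$, and let $S_T\subseteq\mathbb R^d$ and $U\subseteq L^q((0,T);\mathbb R^m)$ be closed sets. Consider the problem $$\min\ \mathcal I(x)=\int_0^T\theta(x(t),t)\,dt+\zeta(x(T))$$ subject to $\dot x(t)=f(x(t),u(t),t)$, $x(0)=x_0$, $x(T)\in S_T$, $u\in U$, and $g_j(x(t),t)\le0$ for all $t\in[0,T]$, $j\in J$. Fix $p\in(1,\infty]$. Let $X$ be the set of all $x\in C([0,T];\mathbb R^d)$ for which there is $u\in U$ such that $f(x(\cdot),u(\cdot),\cdot)$ is integrable and $x(t)=x_0+\int_0^tf(x(\tau),u(\tau),\tau)\,d\tau$ for all $t\in[0,T]$, equipped with the metric $d_X(x,y)=\|x-y\|_p+|x(T)-y(T)|$.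 Put $A=\{x\in X: x(T)\in S_T\}$, $M=\{x\in X: g_j(x(t),t)\le0\ \forall t\in[0,T],\,j\in J\}$, $\Omega=M\cap A$, $g_0\equiv0$, $\phi(x,t)=\max_{j\in J\cup\{0\}}g_j(x,t)$, $\varphi(x)=\|\phi(x(\cdot),\cdot)\|_p$, $\Phi_\lambda=\mathcal I+\lambda\varphi$, and $\partial_x\phi(x,t)=\operatorname{co}\{\nabla_xg_j(x,t): j\in J\cup\{0\},\ g_j(x,t)=\phi(x,t)\}$. Assume: 1. $\zeta$ is locally Lipschitz continuous; $\theta$ and $g_j$, $j\in J$, are continuous and differentiable in $x$, and $\nabla_x\theta$ and $\nabla_xg_j$, $j\in J$, are continuous in $(x,t)$. 2. $X$ is compact in $C([0,T];\mathbb R^d)$ (with the uniform metric), and $\Omega\neq\emptyset$. 3. There exist $a>0$ and $\eta>0$ such that for every $x\in A\setminus\Omega$ there is a sequence $\{x_n\}\subseteq A$, $x_n\ne x$, converging to $x$ in $X$, with $|x_n(T)-x(T)|\le\eta\|x_n-x\|_p$ for all $n$, such that $(x_n-x)/\|x_n-x\|_p$ converges in $L^p((0,T);\mathbb R^d)$ to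 some $h$ satisfying $$\int_0^T\phi(x(t),t)^{p-1}\max_{v\in\partial_x\phi(x(t),t)}\langle v,h(t)\rangle\,dt\le-a\,\varphi(x)^{p-1}$$ if $p<\infty$, and, taking the continuous representative of $h$, $$\langle\nabla_xg_j(x(t),t),h(t)\rangle\le-a\qquad\text{for all }t\in[0,T],\ j\in J\text{ with }g_j(x(t),t)=\varphi(x)$$ if $p=\infty$. Then the penalty function $\Phi_\lambda$ is completely exact on $A$: there exists $\lambda^*\ge0$ such that for every $\lambda\ge\lambda^*$ (i) $\inf_{\Omega}\mathcal I=\inf_A\Phi_\lambda$; (ii) the minimisers of $\mathcal I$ on $\Omega$ and the minimisers of $\Phi_\lambda$ on $A$ coincide; (iii) $x^*\in A$ is a local minimiser (with respect to $d_X$) of $\Phi_\lambda$ on $A$ if and only if $x^*\in\Omega$ and $x^*$ is a local minimiser of $\mathcal I$ on $\Omega$; (iv) $x^*\in A$ is an inf-stationary point of $\Phi_\lambda$ on $A$ if and only if $x^*\in\Omega$ and $x^*$ is an inf-stationary point of $\mathcal I$ on $\Omega$. Here $x^*\in K$ is an inf-stationary point of $F$ on $K$ if $\liminf_{y\to x^*,\,y\in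 K,\,y\ne x^*}\frac{F(y)-F(x^*)}{d_X(y,x^*)}\ge0$, the lower limit being $+\infty$ when $x^*$ is isolated in $K$. -/

import Mathlib

open MeasureTheory Filter Topology Set
open scoped ENNReal

noncomputable section

namespace ExactPenalty

/-! Exact penalty functions on a metric space. -/

section Metric

variable {X : Type*} [MetricSpace X]

/-- The rate of steepest descent of `f` with respect to `K` at `x`, i.e. the lower limit of
`(f y - f x) / d (y, x)` as `y → x`, `y ∈ K`, `y ≠ x`. If `x` is isolated in `K`, the filter is `⊥`
and the value is `⊤`. -/
def steepestDescentRate (K : Set X) (f : X → ℝ) (x : X) : EReal :=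
  liminf (fun y => (((f y - f x) / dist y x : ℝ) : EReal)) (𝓝[K \ {x}] x)

/-- `x` is an inf-stationary point of `f` on `K`. -/
def IsInfStationary (K : Set X) (f : X → ℝ) (x : X) : Prop :=
  x ∈ K ∧ 0 ≤ steepestDescentRate K f x

/-- `x` is a globally optimal solution of `min f` over `K`. -/
def IsGlobalSolution (K : Set X) (f : X → ℝ) (x : X) : Prop :=
  x ∈ K ∧ ∀ y ∈ K, f x ≤ f y

/-- `x` is a locally optimal solution of `min f` over `K`. -/
def IsLocalSolution (K : Set X) (f : X → ℝ) (x : X) : Prop :=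
  x ∈ K ∧ ∃ r > 0, ∀ y ∈ K, dist y x < r → f x ≤ f y

/-- The optimal value of `min f` over `K`, as an extended real number. -/
def optimalValue (K : Set X) (f : X → ℝ) : EReal := ⨅ x ∈ K, (f x : EReal)

/-- The penalty function `Φ_λ = I + λ φ`. -/
def penaltyFunction (I φ : X → ℝ) (lam : ℝ) (x : X) : ℝ := I x + lam * φ x

/-- The penalty function `Φ_λ = I + λ φ` for the problem `min I` over `M ∩ A`, in which the
constraint `x ∈ M` is penalised by `φ`, is completely exact on `A`. -/
def IsCompletelyExactOn (I φ : X → ℝ) (M A : Set X) : Prop :=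
  ∃ lamStar : ℝ, 0 ≤ lamStar ∧ ∀ lam : ℝ, lamStar ≤ lam →
    optimalValue (M ∩ A) I = optimalValue A (penaltyFunction I φ lam) ∧
    (∀ x : X, IsGlobalSolution (M ∩ A) I x ↔ IsGlobalSolution A (penaltyFunction I φ lam) x) ∧
    (∀ x ∈ A, IsLocalSolution A (penaltyFunction I φ lam) x ↔
      x ∈ M ∩ A ∧ IsLocalSolution (M ∩ A) I x) ∧
    (∀ x ∈ A, IsInfStationary A (penaltyFunction I φ lam) x ↔
      x ∈ M ∩ A ∧ IsInfStationary (M ∩ A) I x)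

theorem steepestDescentRate_of_isolated {K : Set X} {f : X → ℝ} {x : X}
    (h : 𝓝[K \ {x}] x = ⊥) : steepestDescentRate K f x = ⊤ := by
  simp [steepestDescentRate, h]

end Metric

/-! The state-constrained variable-endpoint optimal control problem. -/

/-- `ℝ^d` with the Euclidean norm. -/
abbrev Vec (d : ℕ) : Type := EuclideanSpace ℝ (Fin d)

/-- Lebesgue measure on the interval `[0, T]`. -/
def lebesgue (T : ℝ) : Measure (Icc (0 : ℝ) T) := Measure.comap Subtype.val volume

instance (T : ℝ) : IsFiniteMeasure (lebesgue T) := by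
  refine ⟨?_⟩
  rw [lebesgue, comap_subtype_coe_apply measurableSet_Icc, image_univ, Subtype.range_coe]
  exact measure_Icc_lt_top

/-- Data of the problem of minimising `∫₀ᵀ θ(x(t), t) dt + ζ(x(T))` subject to
`x' = f(x, u, t)`, `x(0) = x₀`, `x(T) ∈ S_T`, `u ∈ U` and
`g_j(x(t), t) ≤ 0` for all `t ∈ [0, T]`, `j ∈ J = {1, …, l}`. -/
structure ControlProblem (d m l : ℕ) (q : ℝ≥0∞) [Fact (1 ≤ q)] where
  T : ℝ
  T_pos : 0 < T
  f : Vec d → Vec m → Icc (0 : ℝ) T → Vec d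
  x₀ : Vec d
  U : Set (Lp (Vec m) q (lebesgue T))
  isClosed_U : IsClosed U
  terminalSet : Set (Vec d)
  isClosed_terminalSet : IsClosed terminalSet
  θ : Vec d → Icc (0 : ℝ) T → ℝ
  ζ : Vec d → ℝ
  g : Fin l → Vec d → Icc (0 : ℝ) T → ℝ

namespace ControlProblem

variable {d m l : ℕ} {q : ℝ≥0∞} [Fact (1 ≤ q)] (P : ControlProblem d m l q)

/-- The time interval `[0, T]`, to be used with `lebesgue P.T`. -/
abbrev Time : Type := Icc (0 : ℝ) P.T

/-- The terminal time `T` as a point of `[0, T]`. -/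
def final : P.Time := ⟨P.T, P.T_pos.le, le_rfl⟩

/-- The trajectories: continuous functions `x` on `[0, T]` such that for some control `u ∈ U` one
has `x(t) = x₀ + ∫₀ᵗ f(x(τ), u(τ), τ) dτ` for all `t` (as a Lebesgue integral). -/
def trajectorySet : Set C(P.Time, Vec d) :=
  {x | ∃ u ∈ P.U, Integrable (fun τ : P.Time => P.f (x τ) (u τ) τ) (lebesgue P.T) ∧
    ∀ t : P.Time, x t = P.x₀ + ∫ τ in Iic t, P.f (x τ) (u τ) τ ∂lebesgue P.T}

/-- The type of trajectories, to be equipped with the metric that depends on `p`. -/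
def Trajectory (_p : ℝ≥0∞) : Type := P.trajectorySet

variable {P} {p : ℝ≥0∞}

/-- The continuous function underlying a trajectory. -/
def Trajectory.path (x : P.Trajectory p) : C(P.Time, Vec d) := x.1

/-- The `L^p` norm `‖x - y‖_p` of the difference of two trajectories. -/
def lpDist (x y : P.Trajectory p) : ℝ :=
  (eLpNorm (fun t => x.path t - y.path t) p (lebesgue P.T)).toReal

theorem memLp_path_sub [Fact (1 ≤ p)] (x y : P.Trajectory p) :
    MemLp (fun t => x.path t - y.path t) p (lebesgue P.T) :=
  (x.path - y.path).memLp (p := p) (μ := lebesgue P.T) ℝ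

theorem path_eq_of_lpDist_eq_zero [hp : Fact (1 ≤ p)] {x y : P.Trajectory p}
    (h : lpDist x y = 0) : x.path = y.path := by
  have hm := memLp_path_sub x y
  have h1 : eLpNorm (fun t => x.path t - y.path t) p (lebesgue P.T) = 0 :=
    (ENNReal.toReal_eq_zero_iff _).1 h |>.resolve_right hm.2.ne
  have hp0 : p ≠ 0 := (zero_lt_one.trans_le hp.out).ne'
  have h2 := (eLpNorm_eq_zero_iff hm.1 hp0).1 h1
  have hT : (0 : ℝ) ≤ P.T := P.T_pos.le
  have h3 : (fun s => IccExtend hT x.path s) =ᵐ[volume.restrict (Icc 0 P.T)]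
      (fun s => IccExtend hT y.path s) := by
    refine (ae_restrict_iff_subtype measurableSet_Icc).2 ?_
    filter_upwards [h2] with t ht
    simpa [sub_eq_zero] using ht
  have h4 := Measure.eqOn_Icc_of_ae_eq volume P.T_pos.ne h3
    (x.path.continuous.Icc_extend').continuousOn (y.path.continuous.Icc_extend').continuousOn
  ext1 t
  simpa using h4 t.2

/-- The metric `d_X(x, y) = ‖x - y‖_p + |x(T) - y(T)|` on the space `X` of trajectories. -/
instance [Fact (1 ≤ p)] : MetricSpace (P.Trajectory p) where
  dist x y := lpDist x y + dist (x.path P.final) (y.path P.final)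
  dist_self x := by simp [lpDist]
  dist_comm x y := by
    rw [dist_comm, lpDist, lpDist, ← eLpNorm_neg]
    simp [Pi.neg_def]
  dist_triangle x y z := by
    have h1 := memLp_path_sub x y
    have h2 := memLp_path_sub y z
    have h : lpDist x z ≤ lpDist x y + lpDist y z := by
      unfold lpDist
      rw [← ENNReal.toReal_add h1.2.ne h2.2.ne]
      refine ENNReal.toReal_mono (ENNReal.add_ne_top.2 ⟨h1.2.ne, h2.2.ne⟩) ?_
      refine le_trans (le_of_eq ?_) (eLpNorm_add_le h1.1 h2.1 Fact.out)
      congr 1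
      ext1 t
      simp
    linarith [dist_triangle (x.path P.final) (y.path P.final) (z.path P.final)]
  eq_of_dist_eq_zero := by
    intro x y h
    have h0 : lpDist x y = 0 :=
      le_antisymm (by linarith [dist_nonneg (x := x.path P.final) (y := y.path P.final)])
        ENNReal.toReal_nonneg
    exact Subtype.ext (path_eq_of_lpDist_eq_zero h0)

theorem dist_def [Fact (1 ≤ p)] (x y : P.Trajectory p) :
    dist x y = lpDist x y + ‖x.path P.final - y.path P.final‖ := by
  rw [← dist_eq_norm]; rfl

/-- The cost functional `I(x) = ∫₀ᵀ θ(x(t), t) dt + ζ(x(T))`. -/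
def cost (x : P.Trajectory p) : ℝ :=
  (∫ t, P.θ (x.path t) t ∂lebesgue P.T) + P.ζ (x.path P.final)

variable (P p) in
/-- `A`, the set of trajectories satisfying the endpoint constraint. -/
def A : Set (P.Trajectory p) := {x | x.path P.final ∈ P.terminalSet}

variable (P p) in
/-- `M`, the set of trajectories satisfying the state constraints. -/
def M : Set (P.Trajectory p) := {x | ∀ t : P.Time, ∀ j : Fin l, P.g j (x.path t) t ≤ 0}

variable (P p) in
/-- The feasible region `Ω = M ∩ A`. -/
def Ω : Set (P.Trajectory p) := M P p ∩ A P p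

variable (P) in
/-- The functions `g_j`, `j ∈ J ∪ {0}`, with `g_0 ≡ 0`; the index `0` is `none`. -/
def gExt : Option (Fin l) → Vec d → P.Time → ℝ
  | none => fun _ _ => 0
  | some j => P.g j

variable (P) in
/-- `ϕ(x, t) = max {g_1(x, t), …, g_l(x, t), 0}`. -/
def maxConstr (x : Vec d) (t : P.Time) : ℝ :=
  Finset.univ.sup' Finset.univ_nonempty (fun j => P.gExt j x t)

variable (P) in
/-- `∂ₓϕ(x, t) = co {∇ₓ g_j(x, t) | j ∈ J ∪ {0}, ϕ(x, t) = g_j(x, t)}`. -/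
def subdiff (x : Vec d) (t : P.Time) : Set (Vec d) :=
  convexHull ℝ ((fun j => gradient (fun y => P.gExt j y t) x) ''
    {j | P.maxConstr x t = P.gExt j x t})

variable (P) in
/-- `max {⟨v, w⟩ | v ∈ ∂ₓϕ(x, t)}`; the maximum exists as `∂ₓϕ(x, t)` is nonempty and compact. -/
def maxSubdiff (x : Vec d) (t : P.Time) (w : Vec d) : ℝ :=
  sSup ((fun v => inner ℝ v w) '' P.subdiff x t)

/-- The penalty term `φ(x) = ‖ϕ(x(·), ·)‖_p`. -/
def penaltyTerm (x : P.Trajectory p) : ℝ :=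
  (eLpNorm (fun t => P.maxConstr (x.path t) t) p (lebesgue P.T)).toReal

variable (P) in
/-- Regularity of the data: `ζ` is locally Lipschitz continuous, `θ` and `g_j` are continuous and
differentiable in `x`, and `∇ₓθ` and `∇ₓg_j` are continuous in `(x, t)`. -/
structure IsRegular : Prop where
  locallyLipschitz_ζ : LocallyLipschitz P.ζ
  continuous_θ : Continuous (fun z : Vec d × P.Time => P.θ z.1 z.2)
  differentiable_θ : ∀ t, Differentiable ℝ (fun x => P.θ x t)
  continuous_grad_θ :
    Continuous (fun z : Vec d × P.Time => gradient (fun x => P.θ x z.2) z.1)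
  continuous_g : ∀ j, Continuous (fun z : Vec d × P.Time => P.g j z.1 z.2)
  differentiable_g : ∀ j t, Differentiable ℝ (fun x => P.g j x t)
  continuous_grad_g :
    ∀ j, Continuous (fun z : Vec d × P.Time => gradient (fun x => P.g j x z.2) z.1)

/-- The decrease inequality along `h` at `x`. For `p = ∞` the limit direction `h`, an `L^∞` limit of
continuous functions, is represented by its continuous representative, so that its values at
individual times are meaningful. -/
def DecreaseInequality (a : ℝ) (x : P.Trajectory p) (h : P.Time → Vec d) : Prop :=
  (p ≠ ∞ →
    ∫ t, P.maxConstr (x.path t) t ^ (p.toReal - 1) * P.maxSubdiff (x.path t) t (h t) ∂lebesgue P.T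
      ≤ -a * penaltyTerm x ^ (p.toReal - 1)) ∧
  (p = ∞ → Continuous h ∧
    ∀ t : P.Time, ∀ j : Fin l, penaltyTerm x = P.g j (x.path t) t →
      inner ℝ (gradient (fun y => P.g j y t) (x.path t)) (h t) ≤ -a)

variable (P p) in
/-- The uniform decrease assumption: every infeasible `x ∈ A` is a limit of trajectories
`x_n ∈ A`, `x_n ≠ x`, with `|x_n(T) - x(T)| ≤ η ‖x_n - x‖_p`, such that
`(x_n - x) / ‖x_n - x‖_p` converges in `L^p` to some `h` satisfying the decrease inequality. -/
def UniformDecrease [Fact (1 ≤ p)] : Prop :=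
  ∃ a > 0, ∃ η > 0, ∀ x ∈ A P p \ Ω P p,
    ∃ xs : ℕ → P.Trajectory p, ∃ h : P.Time → Vec d,
      (∀ n, xs n ∈ A P p) ∧ (∀ n, xs n ≠ x) ∧ Tendsto xs atTop (𝓝 x) ∧
      (∀ n, ‖(xs n).path P.final - x.path P.final‖ ≤ η * lpDist (xs n) x) ∧
      MemLp h p (lebesgue P.T) ∧
      Tendsto (fun n => eLpNorm
        (fun t => (lpDist (xs n) x)⁻¹ • ((xs n).path t - x.path t) - h t) p (lebesgue P.T))
        atTop (𝓝 0) ∧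
      DecreaseInequality a x h

end ControlProblem

end ExactPenalty

end

/-! ### Exact penalisation on a compact set in a metric space. -/

namespace ExactPenalty

section Metric

variable {X : Type*} [MetricSpace X]

/-! The theorem splits into a metric principle and an estimate of the penalty term `φ`.

Metric principle. Suppose `A` is compact, `φ` is continuous and, from every infeasible point of `A`,
`φ` decreases along `A` at a rate of at least `b > 0`. Minimising `φ` over the points `y` of `A`
with `b d(x, y) + φ(y) ≤ φ(x)` must end in a feasible point, which gives the error bound `b d(x, y)
≤ φ(x)` with `y` feasible. If the cost is `L`-Lipschitz and `λ b ≥ L + 1`, the penalty beats any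
gain in cost from leaving the feasible set, with one unit of slope to spare. All four forms of
exactness follow from this (`exists_mem_mul_dist_le_of_decrease`,
`isCompletelyExactOn_of_decrease`).

Rate of decrease. For `p < ∞`, Hölder's inequality gives a gradient inequality for the `L^p` norm at
the displaced trajectory `x_n`. Divided by `‖x_n - x‖_p`, its right side converges to the integral
in the hypothesis, because the max-function has Hadamard directional derivatives and the difference
quotients are dominated. For `p = ∞` the quotients converge uniformly, the mean value theorem
handles each constraint near each time, and compactness of `[0, T]` makes this uniform in time. In
both cases the `L^p` slope is at least `a / 2`, and the endpoint bound with constant `η` turns it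
into a slope in `d_X`.

Compactness of the trajectories makes the uniform and `d_X` topologies coincide and puts all
trajectories in one ball, where the data are Lipschitz. -/

/-- Multiplying out the quotient removes the extended reals. The point `y = x` then satisfies the
inequality trivially, and isolated points need no separate case. -/
theorem steepestDescentRate_nonneg_iff {K : Set X} {f : X → ℝ} {x : X} :
    0 ≤ steepestDescentRate K f x ↔
      ∀ ε > 0, ∃ δ > 0, ∀ y ∈ K, dist y x < δ → f x - ε * dist y x ≤ f y := by
  unfold steepestDescentRate
  constructor
  · intro h ε hε
    have h1 : ((-ε : ℝ) : EReal) <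
        liminf (fun y => (((f y - f x) / dist y x : ℝ) : EReal)) (𝓝[K \ {x}] x) :=
      lt_of_lt_of_le (by exact_mod_cast neg_lt_zero.2 hε) h
    have h2 := eventually_lt_of_lt_liminf h1
    obtain ⟨δ, hδ, hball⟩ := Metric.mem_nhdsWithin_iff.1 h2
    refine ⟨δ, hδ, fun y hy hyx => ?_⟩
    by_cases hne : y = x
    · simp [hne]
    have h3 : ((-ε : ℝ) : EReal) < (((f y - f x) / dist y x : ℝ) : EReal) :=
      hball ⟨hyx, hy, hne⟩
    have h4 : -ε < (f y - f x) / dist y x := by exact_mod_cast h3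
    rw [lt_div_iff₀ (dist_pos.2 hne)] at h4
    linarith
  · intro h
    refine le_of_forall_lt fun c hc => ?_
    obtain ⟨r, hcr, hr⟩ := EReal.lt_iff_exists_real_btwn.1 hc
    have hr' : r < 0 := by exact_mod_cast hr
    obtain ⟨δ, hδ, hb⟩ := h (-r) (by linarith)
    refine lt_of_lt_of_le hcr (le_liminf_of_le (by isBoundedDefault) ?_)
    refine Metric.mem_nhdsWithin_iff.2 ⟨δ, hδ, ?_⟩
    rintro y ⟨hyx, hy, hne⟩
    have := hb y hy hyx
    have h4 : r ≤ (f y - f x) / dist y x := by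
      rw [le_div_iff₀ (dist_pos.2 hne)]
      linarith
    exact EReal.coe_le_coe_iff.2 h4

/-- A uniform decrease of `φ` outside of `M` yields a linear error bound. -/
theorem exists_mem_mul_dist_le_of_decrease {φ : X → ℝ} {M A : Set X} {b : ℝ} (hA : IsCompact A)
    (hφ : Continuous φ) (hb : 0 < b)
    (hdec : ∀ x ∈ A, x ∉ M → ∀ δ > 0, ∃ y ∈ A, 0 < dist y x ∧ dist y x < δ ∧
      φ y ≤ φ x - b * dist y x) {x : X} (hx : x ∈ A) :
    ∃ y ∈ M ∩ A, b * dist x y + φ y ≤ φ x := by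
  -- An Ekeland-type argument: by the triangle inequality, a decrease step from a point of this set
  -- stays in the set, so a minimiser of `φ` on it cannot be infeasible.
  have hS : IsCompact (A ∩ {y | b * dist x y + φ y ≤ φ x}) :=
    hA.inter_right (isClosed_le (by fun_prop) continuous_const)
  obtain ⟨y, ⟨hyA, hyS⟩, hmin⟩ := hS.exists_isMinOn ⟨x, hx, by simp⟩ hφ.continuousOn
  by_cases hyM : y ∈ M
  · exact ⟨y, ⟨hyM, hyA⟩, hyS⟩
  obtain ⟨z, hzA, hpos, -, hz⟩ := hdec y hyA hyM 1 one_pos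
  have hzS : b * dist x z + φ z ≤ φ x := by
    have h1 : b * dist x z ≤ b * (dist x y + dist y z) :=
      mul_le_mul_of_nonneg_left (dist_triangle x y z) hb.le
    rw [dist_comm z y] at hz
    simp only [mem_ofPred_eq] at hyS
    linarith
  have h2 : φ y ≤ φ z := hmin ⟨hzA, hzS⟩
  nlinarith [mul_pos hb hpos]

theorem isCompletelyExactOn_of_decrease {I φ : X → ℝ} {M A : Set X} {b L : ℝ} (hA : IsCompact A)
    (hφ : Continuous φ) (hφ0 : ∀ x, 0 ≤ φ x) (hφM : ∀ x, φ x = 0 ↔ x ∈ M) (hb : 0 < b)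
    (hL : 0 ≤ L) (hI : ∀ x y, I x ≤ I y + L * dist x y)
    (hdec : ∀ x ∈ A, x ∉ M → ∀ δ > 0, ∃ y ∈ A, 0 < dist y x ∧ dist y x < δ ∧
      φ y ≤ φ x - b * dist y x) :
    IsCompletelyExactOn I φ M A := by
  -- `L / b` already compensates the change of cost. The extra `1 / b` leaves the term `dist` in
  -- `herr` and `hdesc`, which excludes infeasible solutions and stationary points.
  refine ⟨(L + 1) / b, by positivity, fun lam hlam => ?_⟩
  have hlam0 : 0 ≤ lam := le_trans (by positivity) hlam
  have hlb : L + 1 ≤ lam * b := (div_le_iff₀ hb).1 hlam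
  have hpen : ∀ {x}, x ∈ M → penaltyFunction I φ lam x = I x := fun {x} hx => by
    simp [penaltyFunction, (hφM x).2 hx]
  have herr : ∀ x ∈ A, ∃ y ∈ M ∩ A, b * dist x y ≤ φ x ∧
      I y + dist x y ≤ penaltyFunction I φ lam x := by
    intro x hx
    obtain ⟨y, hy, h⟩ := exists_mem_mul_dist_le_of_decrease hA hφ hb hdec hx
    have h1 : b * dist x y ≤ φ x := by linarith [hφ0 y]
    refine ⟨y, hy, h1, ?_⟩
    have h2 := mul_le_mul_of_nonneg_left h1 hlam0
    have h3 := hI y x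
    have h4 := mul_le_mul_of_nonneg_right hlb (dist_nonneg (x := x) (y := y))
    rw [dist_comm y x] at h3
    unfold penaltyFunction
    linarith
  have hdesc : ∀ x ∈ A, x ∉ M → ∀ δ > 0, ∃ y ∈ A, 0 < dist y x ∧ dist y x < δ ∧
      penaltyFunction I φ lam y + dist y x ≤ penaltyFunction I φ lam x := by
    intro x hx hxM δ hδ
    obtain ⟨y, hy, h0, h1, h2⟩ := hdec x hx hxM δ hδ
    refine ⟨y, hy, h0, h1, ?_⟩
    have h3 := hI y x
    have h4 := mul_le_mul_of_nonneg_right hlb h0.le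
    have h5 := mul_le_mul_of_nonneg_left h2 hlam0
    unfold penaltyFunction
    linarith
  refine ⟨?_, ?_, ?_, ?_⟩
  · refine le_antisymm (le_iInf₂ fun x hx => ?_) (le_iInf₂ fun x hx => ?_)
    · obtain ⟨y, hy, -, h⟩ := herr x hx
      exact (iInf₂_le y hy).trans (EReal.coe_le_coe_iff.2 (by linarith [dist_nonneg (x := x) (y := y)]))
    · exact (iInf₂_le x hx.2).trans (by rw [hpen hx.1])
  · intro x
    constructor
    · rintro ⟨hx, h⟩
      refine ⟨hx.2, fun z hz => ?_⟩
      obtain ⟨y, hy, -, h'⟩ := herr z hz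
      rw [hpen hx.1]
      linarith [h y hy, dist_nonneg (x := z) (y := y)]
    · rintro ⟨hx, h⟩
      have hxM : x ∈ M := by
        by_contra hxM
        obtain ⟨y, hy, h0, -, h'⟩ := hdesc x hx hxM 1 one_pos
        linarith [h y hy]
      refine ⟨⟨hxM, hx⟩, fun z hz => ?_⟩
      have := h z hz.2
      rwa [hpen hxM, hpen hz.1] at this
  · intro x hx
    constructor
    · rintro ⟨-, r, hr, h⟩
      have hxM : x ∈ M := by
        by_contra hxM
        obtain ⟨y, hy, h0, h1, h'⟩ := hdesc x hx hxM r hr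
        linarith [h y hy h1]
      refine ⟨⟨hxM, hx⟩, ⟨hxM, hx⟩, r, hr, fun z hz hzr => ?_⟩
      have := h z hz.2 hzr
      rwa [hpen hxM, hpen hz.1] at this
    · rintro ⟨⟨hxM, -⟩, -, r, hr, h⟩
      -- Near the feasible point `x` the penalty is small, so the error bound puts the feasible
      -- companion `y` of `z` within `r / 2` of `z`, hence in the ball where `x` is optimal.
      have hev : ∀ᶠ z in 𝓝 x, φ z < b * (r / 2) :=
        hφ.continuousAt.eventually_lt_const (by rw [(hφM x).2 hxM]; positivity)
      obtain ⟨δ, hδ, hball⟩ := Metric.eventually_nhds_iff.1 hev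
      refine ⟨hx, min δ (r / 2), by positivity, fun z hz hzd => ?_⟩
      obtain ⟨y, hy, h1, h2⟩ := herr z hz
      have h3 : dist z y < r / 2 :=
        lt_of_mul_lt_mul_left (h1.trans_lt (hball (hzd.trans_le (min_le_left _ _)))) hb.le
      have h4 : dist y x < r := by
        have := dist_triangle y z x
        rw [dist_comm y z] at this
        linarith [hzd.trans_le (min_le_right δ (r / 2))]
      rw [hpen hxM]
      linarith [h y hy h4, dist_nonneg (x := z) (y := y)]
  · intro x hx
    unfold IsInfStationary
    simp only [steepestDescentRate_nonneg_iff]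
    constructor
    · rintro ⟨-, h⟩
      have hxM : x ∈ M := by
        by_contra hxM
        obtain ⟨δ, hδ, h⟩ := h (1 / 2) (by norm_num)
        obtain ⟨y, hy, h0, h1, h'⟩ := hdesc x hx hxM δ hδ
        linarith [h y hy h1]
      refine ⟨⟨hxM, hx⟩, ⟨hxM, hx⟩, fun ε hε => ?_⟩
      obtain ⟨δ, hδ, h⟩ := h ε hε
      refine ⟨δ, hδ, fun z hz hzr => ?_⟩
      have := h z hz.2 hzr
      rwa [hpen hxM, hpen hz.1] at this
    · rintro ⟨⟨hxM, -⟩, -, h⟩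
      refine ⟨hx, fun ε hε => ?_⟩
      -- Capping the slope at `1` lets the spare term `dist z y` of `herr` absorb the error made in
      -- passing from `z` to `y`.
      obtain ⟨r, hr, h⟩ := h (min ε 1) (by positivity)
      have hev : ∀ᶠ z in 𝓝 x, φ z < b * (r / 2) :=
        hφ.continuousAt.eventually_lt_const (by rw [(hφM x).2 hxM]; positivity)
      obtain ⟨δ, hδ, hball⟩ := Metric.eventually_nhds_iff.1 hev
      refine ⟨min δ (r / 2), by positivity, fun z hz hzd => ?_⟩
      obtain ⟨y, hy, h1, h2⟩ := herr z hz
      have h3 : dist z y < r / 2 :=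
        lt_of_mul_lt_mul_left (h1.trans_lt (hball (hzd.trans_le (min_le_left _ _)))) hb.le
      have htri := dist_triangle y z x
      rw [dist_comm y z] at htri
      have h4 : dist y x < r := by linarith [hzd.trans_le (min_le_right δ (r / 2))]
      rw [hpen hxM]
      have h5 := h y hy h4
      have h6 : min ε 1 * dist y x ≤ min ε 1 * (dist z y + dist z x) :=
        mul_le_mul_of_nonneg_left htri (by positivity)
      have h7 : min ε 1 * dist z y ≤ 1 * dist z y :=
        mul_le_mul_of_nonneg_right (min_le_right _ _) dist_nonneg
      have h8 : min ε 1 * dist z x ≤ ε * dist z x :=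
        mul_le_mul_of_nonneg_right (min_le_left _ _) dist_nonneg
      linarith

end Metric
end ExactPenalty

/-! ### Gradients and Lipschitz bounds for the constraints. -/

namespace ExactPenalty

section Gradient

variable {F : Type*} [NormedAddCommGroup F] [InnerProductSpace ℝ F] [CompleteSpace F]

theorem inner_gradient_eq_fderiv (f : F → ℝ) (x w : F) :
    inner ℝ (gradient f x) w = fderiv ℝ f x w := by
  rw [← toDual_gradient, InnerProductSpace.toDual_apply_apply]

theorem norm_gradient_eq_norm_fderiv (f : F → ℝ) (x : F) :
    ‖gradient f x‖ = ‖fderiv ℝ f x‖ := by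
  rw [← toDual_gradient, LinearIsometryEquiv.norm_map]

/-- The gradient is bounded on the compact product of the ball with `τ`, and the ball is convex, so
the mean value inequality applies. -/
theorem exists_uniform_lipschitz_on_closedBall [ProperSpace F] {τ : Type*} [TopologicalSpace τ]
    [CompactSpace τ] {G : F → τ → ℝ} (hd : ∀ t, Differentiable ℝ fun x => G x t)
    (hg : Continuous fun z : F × τ => gradient (fun x => G x z.2) z.1) (R : ℝ) :
    ∃ L, 0 ≤ L ∧ ∀ t, ∀ y ∈ Metric.closedBall (0 : F) R, ∀ z ∈ Metric.closedBall (0 : F) R,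
      |G y t - G z t| ≤ L * ‖y - z‖ := by
  obtain ⟨C, hC⟩ := ((isCompact_closedBall (0 : F) R).prod
    (isCompact_univ (X := τ))).exists_bound_of_continuousOn hg.continuousOn
  refine ⟨max C 0, le_max_right _ _, fun t y hy z hz => ?_⟩
  refine (convex_closedBall (0 : F) R).norm_image_sub_le_of_norm_fderiv_le (𝕜 := ℝ)
    (f := fun x => G x t) (fun x _ => hd t x) (fun x hx => ?_) hz hy
  rw [← norm_gradient_eq_norm_fderiv]
  exact (hC (x, t) ⟨hx, mem_univ _⟩).trans (le_max_left _ _)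

end Gradient

namespace ControlProblem

variable {d m l : ℕ} {q : ℝ≥0∞} [Fact (1 ≤ q)] {P : ControlProblem d m l q} {p : ℝ≥0∞}

section Constraints

theorem IsRegular.continuous_gExt (hreg : P.IsRegular) (j : Option (Fin l)) :
    Continuous fun z : Vec d × P.Time => P.gExt j z.1 z.2 := by
  cases j with
  | none => exact continuous_const
  | some j => exact hreg.continuous_g j

theorem IsRegular.differentiable_gExt (hreg : P.IsRegular) (j : Option (Fin l)) (t : P.Time) :
    Differentiable ℝ fun x => P.gExt j x t := by
  cases j with
  | none => exact differentiable_const _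
  | some j => exact hreg.differentiable_g j t

theorem IsRegular.continuous_grad_gExt (hreg : P.IsRegular) (j : Option (Fin l)) :
    Continuous fun z : Vec d × P.Time => gradient (fun x => P.gExt j x z.2) z.1 := by
  cases j with
  | none => simpa [gExt] using continuous_const
  | some j => exact hreg.continuous_grad_g j

theorem gExt_le_maxConstr (j : Option (Fin l)) (x : Vec d) (t : P.Time) :
    P.gExt j x t ≤ P.maxConstr x t :=
  Finset.le_sup' (fun j => P.gExt j x t) (Finset.mem_univ j)

theorem maxConstr_nonneg (x : Vec d) (t : P.Time) : 0 ≤ P.maxConstr x t :=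
  gExt_le_maxConstr none x t

theorem exists_gExt_eq_maxConstr (x : Vec d) (t : P.Time) :
    ∃ j, P.maxConstr x t = P.gExt j x t := by
  obtain ⟨j, -, hj⟩ := Finset.exists_mem_eq_sup' Finset.univ_nonempty fun j => P.gExt j x t
  exact ⟨j, hj⟩

theorem IsRegular.continuous_maxConstr (hreg : P.IsRegular) :
    Continuous fun z : Vec d × P.Time => P.maxConstr z.1 z.2 :=
  Continuous.finset_sup'_apply _ fun j _ => hreg.continuous_gExt j

theorem IsRegular.exists_lipschitz_maxConstr (hreg : P.IsRegular) (R : ℝ) :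
    ∃ L, 0 ≤ L ∧ ∀ t : P.Time, ∀ y ∈ Metric.closedBall (0 : Vec d) R,
      ∀ z ∈ Metric.closedBall (0 : Vec d) R,
      |P.maxConstr y t - P.maxConstr z t| ≤ L * ‖y - z‖ := by
  choose L hL0 hL using fun j : Option (Fin l) =>
    exists_uniform_lipschitz_on_closedBall (hreg.differentiable_gExt j)
      (hreg.continuous_grad_gExt j) R
  have key : ∀ t : P.Time, ∀ y ∈ Metric.closedBall (0 : Vec d) R,
      ∀ z ∈ Metric.closedBall (0 : Vec d) R,
      P.maxConstr y t - P.maxConstr z t ≤ (∑ j, L j) * ‖y - z‖ := by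
    intro t y hy z hz
    -- Comparing through an index that attains the maximum at `y` gives a one-sided bound;
    -- exchanging `y` and `z` gives the other.
    obtain ⟨j, hj⟩ := exists_gExt_eq_maxConstr (P := P) y t
    have h1 := (abs_le.1 (hL j t y hy z hz)).2
    have h2 := gExt_le_maxConstr (P := P) j z t
    have h3 : L j * ‖y - z‖ ≤ (∑ j, L j) * ‖y - z‖ :=
      mul_le_mul_of_nonneg_right
        (Finset.single_le_sum (fun i _ => hL0 i) (Finset.mem_univ j)) (norm_nonneg _)
    linarith
  refine ⟨∑ j, L j, Finset.sum_nonneg fun i _ => hL0 i, fun t y hy z hz => abs_le.2 ⟨?_, ?_⟩⟩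
  · have := key t z hz y hy
    rw [norm_sub_rev] at this
    linarith
  · exact key t y hy z hz

end Constraints

/-! ### The topology of the space of trajectories. -/

section Topology

theorem ext_path {x y : P.Trajectory p} (h : x.path = y.path) : x = y := Subtype.ext h

theorem lpDist_nonneg (x y : P.Trajectory p) : 0 ≤ lpDist x y := ENNReal.toReal_nonneg

theorem exists_lpDist_le_norm :
    ∃ C : ℝ, ∀ x y : P.Trajectory p, lpDist x y ≤ C * ‖x.path - y.path‖ := by
  -- For `p = ∞` the exponent is `0` by convention, and the constant is `1`, as it should be.
  refine ⟨(lebesgue P.T univ ^ p.toReal⁻¹).toReal, fun x y => ?_⟩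
  have h := eLpNorm_le_of_ae_bound (μ := lebesgue P.T) (p := p)
    (f := fun t => x.path t - y.path t) (C := ‖x.path - y.path‖)
    (Eventually.of_forall fun t => (x.path - y.path).norm_coe_le_norm t)
  have hfin : lebesgue P.T univ ^ p.toReal⁻¹ ≠ ∞ :=
    ENNReal.rpow_ne_top_of_nonneg (by positivity) (measure_ne_top _ _)
  have h2 := ENNReal.toReal_mono (ENNReal.mul_ne_top hfin ENNReal.ofReal_ne_top) h
  rwa [ENNReal.toReal_mul, ENNReal.toReal_ofReal (norm_nonneg _)] at h2

theorem exists_path_mem_closedBall (hc : IsCompact P.trajectorySet) :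
    ∃ R, ∀ (x : P.Trajectory p) (t : P.Time), x.path t ∈ Metric.closedBall (0 : Vec d) R := by
  obtain ⟨R, hR⟩ := hc.isBounded.exists_norm_le
  refine ⟨R, fun x t => ?_⟩
  rw [mem_closedBall_zero_iff]
  exact (x.path.norm_coe_le_norm t).trans (hR _ x.2)

variable (P p) in
/-- The trajectories with the uniform topology, as the trajectories with the metric `d_X`. -/
def ofUniform : P.trajectorySet ≃ P.Trajectory p := Equiv.refl _

variable [hp : Fact (1 ≤ p)]

theorem lpDist_le_dist (x y : P.Trajectory p) : lpDist x y ≤ dist x y := by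
  rw [dist_def]
  exact le_add_of_nonneg_right (norm_nonneg _)

theorem lpDist_pos {x y : P.Trajectory p} (h : x ≠ y) : 0 < lpDist x y :=
  (lpDist_nonneg x y).lt_of_ne fun h0 => h (ext_path (path_eq_of_lpDist_eq_zero h0.symm))

theorem continuous_ofUniform : Continuous (ofUniform P p) := by
  obtain ⟨C, hC⟩ := exists_lpDist_le_norm (P := P) (p := p)
  refine (LipschitzWith.of_dist_le_mul (K := (C + 1).toNNReal) fun x y => ?_).continuous
  have h1 := hC (ofUniform P p x) (ofUniform P p y)
  have h2 := (x.1 - y.1).norm_coe_le_norm P.final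
  rw [Subtype.dist_eq, dist_eq_norm, dist_def]
  refine le_trans (b := (C + 1) * ‖x.1 - y.1‖) ?_
    (mul_le_mul_of_nonneg_right (Real.le_coe_toNNReal _) (norm_nonneg _))
  rw [add_mul, one_mul]
  exact add_le_add h1 h2

theorem compactSpace_trajectory (hc : IsCompact P.trajectorySet) :
    CompactSpace (P.Trajectory p) := by
  have := isCompact_iff_compactSpace.1 hc
  exact (ofUniform P p).surjective.compactSpace continuous_ofUniform

/-- A continuous bijection from a compact space to a Hausdorff space is a homeomorphism, so
convergence in `d_X` is uniform convergence. -/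
theorem continuous_path (hc : IsCompact P.trajectorySet) :
    Continuous (Trajectory.path : P.Trajectory p → C(P.Time, Vec d)) := by
  have := isCompact_iff_compactSpace.1 hc
  exact continuous_subtype_val.comp
    (continuous_ofUniform (P := P) (p := p)).homeoOfEquivCompactToT2.symm.continuous

theorem continuous_path_apply (hc : IsCompact P.trajectorySet) (t : P.Time) :
    Continuous fun x : P.Trajectory p => x.path t :=
  (continuous_eval_const t).comp (continuous_path hc)

theorem isClosed_A (hc : IsCompact P.trajectorySet) : IsClosed (A P p) :=
  P.isClosed_terminalSet.preimage (continuous_path_apply hc P.final)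

end Topology

/-! ### Lipschitz continuity of the penalty term and of the cost. -/

section Functionals

theorem IsRegular.continuous_maxConstr_path (hreg : P.IsRegular) (x : P.Trajectory p) :
    Continuous fun t => P.maxConstr (x.path t) t :=
  hreg.continuous_maxConstr.comp (x.path.continuous.prodMk continuous_id)

theorem _root_.Continuous.memLp_lebesgue {E : Type*} [NormedAddCommGroup E]
    [SecondCountableTopology E] {T : ℝ} {f : Icc (0 : ℝ) T → E} (hf : Continuous f) (r : ℝ≥0∞) :
    MemLp f r (lebesgue T) := by
  obtain ⟨C, hC⟩ := (isCompact_univ (X := Icc (0 : ℝ) T)).exists_bound_of_continuousOn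
    hf.continuousOn
  exact MemLp.of_bound hf.aestronglyMeasurable C (Eventually.of_forall fun t => hC t (mem_univ t))

/-- The continuous functions `max f c` and `c` agree almost everywhere, hence everywhere on a
nondegenerate interval. -/
theorem _root_.Continuous.le_of_ae_le_lebesgue {T c : ℝ} (hT : 0 < T) {f : Icc (0 : ℝ) T → ℝ}
    (hf : Continuous f) (h : ∀ᵐ t ∂lebesgue T, f t ≤ c) (t : Icc (0 : ℝ) T) : f t ≤ c := by
  have h3 : (fun s => IccExtend hT.le (fun t => max (f t) c) s) =ᵐ[volume.restrict (Icc 0 T)]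
      (fun _ => c) := by
    refine (ae_restrict_iff_subtype measurableSet_Icc).2 ?_
    filter_upwards [h] with t ht
    simpa using ht
  have h4 := Measure.eqOn_Icc_of_ae_eq volume hT.ne h3
    ((hf.max continuous_const).Icc_extend').continuousOn continuousOn_const
  simpa using h4 t.2

theorem penaltyTerm_nonneg (x : P.Trajectory p) : 0 ≤ penaltyTerm x := ENNReal.toReal_nonneg

variable [hp : Fact (1 ≤ p)]

theorem IsRegular.penaltyTerm_eq_zero_iff (hreg : P.IsRegular) (x : P.Trajectory p) :
    penaltyTerm x = 0 ↔ x ∈ M P p := by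
  have hm := (hreg.continuous_maxConstr_path x).memLp_lebesgue p
  have hp0 : p ≠ 0 := (zero_lt_one.trans_le hp.out).ne'
  constructor
  · intro h t j
    have h1 := (ENNReal.toReal_eq_zero_iff _).1 h |>.resolve_right hm.2.ne
    have h2 := (eLpNorm_eq_zero_iff hm.1 hp0).1 h1
    refine (gExt_le_maxConstr (some j) (x.path t) t).trans ?_
    exact (hreg.continuous_maxConstr_path x).le_of_ae_le_lebesgue P.T_pos
      (h2.mono fun t ht => ht.le) t
  · intro h
    have h1 : (fun t => P.maxConstr (x.path t) t) = 0 := by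
      ext t
      refine le_antisymm (Finset.sup'_le _ _ fun j _ => ?_) (maxConstr_nonneg _ _)
      cases j with
      | none => exact le_rfl
      | some j => exact h t j
    simp [penaltyTerm, h1]

theorem IsRegular.exists_lipschitz_penaltyTerm (hreg : P.IsRegular)
    (hc : IsCompact P.trajectorySet) :
    ∃ L : ℝ, 0 ≤ L ∧ ∀ x y : P.Trajectory p, penaltyTerm x ≤ penaltyTerm y + L * lpDist x y := by
  obtain ⟨R, hR⟩ := exists_path_mem_closedBall (p := p) hc
  obtain ⟨L, hL0, hL⟩ := hreg.exists_lipschitz_maxConstr R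
  refine ⟨L, hL0, fun x y => ?_⟩
  have hx := (hreg.continuous_maxConstr_path x).memLp_lebesgue p
  have hy := (hreg.continuous_maxConstr_path y).memLp_lebesgue p
  have hxy := memLp_path_sub x y
  have h1 : eLpNorm (fun t => P.maxConstr (x.path t) t - P.maxConstr (y.path t) t) p (lebesgue P.T)
      ≤ ENNReal.ofReal L * eLpNorm (fun t => x.path t - y.path t) p (lebesgue P.T) :=
    eLpNorm_le_mul_eLpNorm_of_ae_le_mul
      (Eventually.of_forall fun t => hL t _ (hR x t) _ (hR y t)) p
  have h2 : eLpNorm (fun t => P.maxConstr (x.path t) t) p (lebesgue P.T) ≤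
      eLpNorm (fun t => P.maxConstr (y.path t) t) p (lebesgue P.T) +
      eLpNorm (fun t => P.maxConstr (x.path t) t - P.maxConstr (y.path t) t) p (lebesgue P.T) := by
    refine le_trans (le_of_eq ?_) (eLpNorm_add_le hy.1 (hx.sub hy).1 hp.out)
    congr 1
    ext t
    simp
  have h3 := ENNReal.toReal_mono (ENNReal.add_ne_top.2
    ⟨hy.2.ne, ENNReal.mul_ne_top ENNReal.ofReal_ne_top hxy.2.ne⟩) (h2.trans (by gcongr))
  rwa [ENNReal.toReal_add hy.2.ne (ENNReal.mul_ne_top ENNReal.ofReal_ne_top hxy.2.ne),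
    ENNReal.toReal_mul, ENNReal.toReal_ofReal hL0] at h3

theorem IsRegular.continuous_penaltyTerm (hreg : P.IsRegular) (hc : IsCompact P.trajectorySet) :
    Continuous (penaltyTerm : P.Trajectory p → ℝ) := by
  obtain ⟨L, hL0, hL⟩ := hreg.exists_lipschitz_penaltyTerm (p := p) hc
  refine LipschitzWith.continuous (K := L.toNNReal) (LipschitzWith.of_le_add_mul _ fun x y => ?_)
  rw [Real.coe_toNNReal _ hL0]
  exact (hL x y).trans (by gcongr; exact lpDist_le_dist x y)

/-- On a finite measure space the `L^1` distance is bounded by a multiple of the `L^p` distance. -/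
theorem exists_integral_norm_le_lpDist (hp1 : 1 ≤ p) :
    ∃ C : ℝ, 0 ≤ C ∧ ∀ f : P.Time → Vec d, MemLp f p (lebesgue P.T) →
      ∫ t, ‖f t‖ ∂lebesgue P.T ≤ C * (eLpNorm f p (lebesgue P.T)).toReal := by
  -- The Hölder exponent `1 - 1/p`; for `p = ∞` the convention `1 / 0 = 0` gives the correct value
  -- `1`.
  set e : ℝ := 1 / (1 : ℝ≥0∞).toReal - 1 / p.toReal with he
  have he0 : 0 ≤ e := by
    rcases eq_or_ne p ∞ with rfl | hpt
    · simp [he]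
    · have : 1 ≤ p.toReal := by simpa using ENNReal.toReal_mono hpt hp1
      simp only [he, ENNReal.toReal_one, div_one, sub_nonneg]
      exact (div_le_one (by linarith)).2 this
  have hfin : lebesgue P.T univ ^ e ≠ ∞ :=
    ENNReal.rpow_ne_top_of_nonneg he0 (measure_ne_top _ _)
  refine ⟨(lebesgue P.T univ ^ e).toReal, ENNReal.toReal_nonneg, fun f hf => ?_⟩
  have h := eLpNorm_le_eLpNorm_mul_rpow_measure_univ (μ := lebesgue P.T) hp1 hf.1
  have h2 := ENNReal.toReal_mono (ENNReal.mul_ne_top hf.2.ne hfin) h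
  rw [ENNReal.toReal_mul, eLpNorm_one_eq_lintegral_enorm, ← integral_norm_eq_lintegral_enorm hf.1,
    mul_comm] at h2
  exact h2

/-- The integral cost is controlled by the `L^1` distance, hence by the `L^p` distance. The terminal
cost needs the endpoint term of `d_X`. -/
theorem IsRegular.exists_lipschitz_cost (hreg : P.IsRegular) (hc : IsCompact P.trajectorySet) :
    ∃ L : ℝ, 0 ≤ L ∧ ∀ x y : P.Trajectory p, cost x ≤ cost y + L * dist x y := by
  obtain ⟨R, hR⟩ := exists_path_mem_closedBall (p := p) hc
  obtain ⟨L, hL0, hL⟩ := exists_uniform_lipschitz_on_closedBall hreg.differentiable_θ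
    hreg.continuous_grad_θ R
  obtain ⟨C, hC0, hC⟩ := exists_integral_norm_le_lpDist (P := P) (p := p) hp.out
  obtain ⟨K, hK⟩ := LocallyLipschitzOn.exists_lipschitzOnWith_of_compact
    (isCompact_closedBall (0 : Vec d) R) (f := P.ζ)
    hreg.locallyLipschitz_ζ.locallyLipschitzOn
  have hint : ∀ x : P.Trajectory p, Integrable (fun t => P.θ (x.path t) t) (lebesgue P.T) :=
    fun x => memLp_one_iff_integrable.1 (Continuous.memLp_lebesgue
      (hreg.continuous_θ.comp (x.path.continuous.prodMk continuous_id)) 1)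
  refine ⟨L * C + K, by positivity, fun x y => ?_⟩
  have h1 : (∫ t, P.θ (x.path t) t ∂lebesgue P.T) - ∫ t, P.θ (y.path t) t ∂lebesgue P.T ≤
      L * ∫ t, ‖x.path t - y.path t‖ ∂lebesgue P.T := by
    rw [← integral_sub (hint x) (hint y), ← integral_const_mul]
    refine integral_mono ((hint x).sub (hint y)) ?_ fun t => (abs_le.1 (hL t _ (hR x t) _ (hR y t))).2
    exact (memLp_one_iff_integrable.1 ((x.path - y.path).continuous.memLp_lebesgue 1)).norm.const_mul L
  have h2 := mul_le_mul_of_nonneg_left (hC _ (memLp_path_sub x y)) hL0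
  have h3 := hK.dist_le_mul _ (hR x P.final) _ (hR y P.final)
  rw [Real.dist_eq, dist_eq_norm] at h3
  have h4 := (abs_le.1 h3).2
  have h5 : L * C * lpDist x y ≤ L * C * dist x y :=
    mul_le_mul_of_nonneg_left (lpDist_le_dist x y) (by positivity)
  have h6 : (K : ℝ) * ‖x.path P.final - y.path P.final‖ ≤ K * dist x y := by
    rw [dist_def]
    exact mul_le_mul_of_nonneg_left (le_add_of_nonneg_left (lpDist_nonneg x y)) K.2
  simp only [cost, lpDist] at h5 ⊢
  linarith

end Functionals
end ControlProblem
end ExactPenalty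

/-! ### Dominated convergence with varying dominating functions. -/

namespace ExactPenalty

section Integral

variable {α : Type*} [MeasurableSpace α] {μ : Measure α} {E : Type*} [NormedAddCommGroup E]

/-- Dominated convergence with dominating functions `K ‖h n‖`, where `h n` converges in `L^1`. -/
theorem tendsto_integral_of_le_mul_norm {F : ℕ → α → ℝ} {f : α → ℝ} {h : ℕ → α → E} {h₀ : α → E}
    {K : ℝ} (hK : 0 ≤ K) (hF : ∀ n, AEStronglyMeasurable (F n) μ) (hh : ∀ n, Integrable (h n) μ)
    (hh₀ : Integrable h₀ μ) (hbound : ∀ n t, |F n t| ≤ K * ‖h n t‖)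
    (hL1 : Tendsto (fun n => ∫ t, ‖h n t - h₀ t‖ ∂μ) atTop (𝓝 0))
    (hae : ∀ᵐ t ∂μ, Tendsto (fun n => h n t) atTop (𝓝 (h₀ t)))
    (hlim : ∀ᵐ t ∂μ, Tendsto (fun n => F n t) atTop (𝓝 (f t))) :
    Tendsto (fun n => ∫ t, F n t ∂μ) atTop (𝓝 (∫ t, f t ∂μ)) := by
  -- Clamping `F n` to the limiting bound gives a fixed dominating function, and changes `F n` by at
  -- most `K ‖h n - h₀‖`, which tends to `0` in `L^1`.
  set G : ℕ → α → ℝ := fun n t => max (-(K * ‖h₀ t‖)) (min (F n t) (K * ‖h₀ t‖)) with hG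
  have hb : Integrable (fun t => K * ‖h₀ t‖) μ := hh₀.norm.const_mul K
  have hGm : ∀ n, AEStronglyMeasurable (G n) μ := fun n =>
    hb.1.neg.sup ((hF n).inf hb.1)
  have hGb : ∀ n t, ‖G n t‖ ≤ K * ‖h₀ t‖ := fun n t => by
    have : 0 ≤ K * ‖h₀ t‖ := by positivity
    exact abs_le.2 ⟨le_max_left _ _, max_le (by linarith) (min_le_right _ _)⟩
  have hGlim : Tendsto (fun n => ∫ t, G n t ∂μ) atTop (𝓝 (∫ t, f t ∂μ)) := by
    refine tendsto_integral_of_dominated_convergence _ hGm hb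
      (fun n => Eventually.of_forall (hGb n)) ?_
    filter_upwards [hae, hlim] with t ht1 ht2
    have h1 : |f t| ≤ K * ‖h₀ t‖ :=
      le_of_tendsto_of_tendsto' ht2.abs (ht1.norm.const_mul K) fun n => hbound n t
    have h2 : max (-(K * ‖h₀ t‖)) (min (f t) (K * ‖h₀ t‖)) = f t := by
      rw [min_eq_left (abs_le.1 h1).2, max_eq_right (abs_le.1 h1).1]
    rw [← h2]
    exact tendsto_const_nhds.max (ht2.min tendsto_const_nhds)
  have hFi : ∀ n, Integrable (F n) μ := fun n =>
    ((hh n).norm.const_mul K).mono' (hF n) (Eventually.of_forall (hbound n))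
  have hGi : ∀ n, Integrable (G n) μ := fun n => hb.mono' (hGm n) (Eventually.of_forall (hGb n))
  have hdiff : ∀ n t, ‖F n t - G n t‖ ≤ K * ‖h n t - h₀ t‖ := by
    intro n t
    have h1 := abs_le.1 (hbound n t)
    have h2 : K * ‖h n t‖ ≤ K * ‖h₀ t‖ + K * ‖h n t - h₀ t‖ := by
      rw [← mul_add]
      exact mul_le_mul_of_nonneg_left (norm_le_insert' _ _) hK
    have h3 : 0 ≤ K * ‖h n t - h₀ t‖ := by positivity
    have h4 : 0 ≤ K * ‖h₀ t‖ := by positivity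
    rw [Real.norm_eq_abs, abs_le]
    simp only [hG]
    rcases le_total (F n t) (K * ‖h₀ t‖) with h5 | h5
    · rw [min_eq_left h5]
      rcases le_total (-(K * ‖h₀ t‖)) (F n t) with h6 | h6
      · rw [max_eq_right h6]
        constructor <;> linarith
      · rw [max_eq_left h6]
        constructor <;> linarith
    · rw [min_eq_right h5, max_eq_right (by linarith)]
      constructor <;> linarith
  have hzero : Tendsto (fun n => (∫ t, F n t ∂μ) - ∫ t, G n t ∂μ) atTop (𝓝 0) := by
    have hL1' := hL1.const_mul K
    rw [mul_zero] at hL1'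
    refine squeeze_zero_norm (fun n => ?_) hL1'
    rw [← integral_sub (hFi n) (hGi n), ← integral_const_mul]
    exact norm_integral_le_of_norm_le (((hh n).sub hh₀).norm.const_mul K)
      (Eventually.of_forall (hdiff n))
  simpa using hzero.add hGlim

end Integral

namespace ControlProblem

variable {d m l : ℕ} {q : ℝ≥0∞} [Fact (1 ≤ q)] {P : ControlProblem d m l q} {p : ℝ≥0∞}

/-! ### Directional derivative of the max-function. -/

section DirectionalDerivative

variable (P) in
open Classical in
/-- The indices `j ∈ J ∪ {0}` with `g_j(x, t) = ϕ(x, t)`. -/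
noncomputable def activeSet (x : Vec d) (t : P.Time) : Finset (Option (Fin l)) :=
  Finset.univ.filter fun j => P.maxConstr x t = P.gExt j x t

theorem mem_activeSet {x : Vec d} {t : P.Time} {j : Option (Fin l)} :
    j ∈ P.activeSet x t ↔ P.maxConstr x t = P.gExt j x t := by
  simp [activeSet]

theorem activeSet_nonempty (x : Vec d) (t : P.Time) : (P.activeSet x t).Nonempty := by
  obtain ⟨j, hj⟩ := exists_gExt_eq_maxConstr (P := P) x t
  exact ⟨j, mem_activeSet.2 hj⟩

/-- A linear functional has the same supremum on a convex hull as on its generators, here finitely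
many gradients. -/
theorem maxSubdiff_eq_sup' (x : Vec d) (t : P.Time) (w : Vec d) :
    P.maxSubdiff x t w = (P.activeSet x t).sup' (activeSet_nonempty x t)
      fun j => inner ℝ (gradient (fun y => P.gExt j y t) x) w := by
  set s := (P.activeSet x t).sup' (activeSet_nonempty x t)
      fun j => inner ℝ (gradient (fun y => P.gExt j y t) x) w with hs
  have hub : ∀ r ∈ (fun v => inner ℝ v w) '' P.subdiff x t, r ≤ s := by
    rintro _ ⟨v, hv, rfl⟩
    have hsub : P.subdiff x t ⊆ {v | inner ℝ v w ≤ s} := by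
      refine convexHull_min ?_ (convex_halfSpace_le ⟨fun a b => inner_add_left _ _ _,
        fun c a => by simp [inner_smul_left]⟩ s)
      rintro _ ⟨j, hj, rfl⟩
      exact Finset.le_sup' (fun j => inner ℝ (gradient (fun y => P.gExt j y t) x) w)
        (mem_activeSet.2 hj)
    exact hsub hv
  have hmem : ∀ j ∈ P.activeSet x t, inner ℝ (gradient (fun y => P.gExt j y t) x) w ∈
      (fun v => inner ℝ v w) '' P.subdiff x t := fun j hj =>
    ⟨_, subset_convexHull ℝ _ ⟨j, mem_activeSet.1 hj, rfl⟩, rfl⟩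
  obtain ⟨j₀, hj₀⟩ := activeSet_nonempty (P := P) x t
  exact le_antisymm (csSup_le ⟨_, hmem j₀ hj₀⟩ hub)
    (Finset.sup'_le _ _ fun j hj => le_csSup ⟨s, hub⟩ (hmem j hj))

/-- The Hadamard directional derivative of the max-function `ϕ(·, t)`. -/
theorem IsRegular.tendsto_maxConstr_quotient (hreg : P.IsRegular) (x : Vec d) (t : P.Time)
    {α : ℕ → ℝ} {v : ℕ → Vec d} {w : Vec d} (hα : ∀ n, 0 < α n) (hα0 : Tendsto α atTop (𝓝 0))
    (hv : Tendsto v atTop (𝓝 w)) :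
    Tendsto (fun n => (α n)⁻¹ * (P.maxConstr (x + α n • v n) t - P.maxConstr x t)) atTop
      (𝓝 (P.maxSubdiff x t w)) := by
  have hstep : Tendsto (fun n => α n • v n) atTop (𝓝 0) := by
    simpa using hα0.smul hv
  have hy : Tendsto (fun n => x + α n • v n) atTop (𝓝 x) := by
    simpa using hstep.const_add x
  have hquot : ∀ j, Tendsto (fun n => (α n)⁻¹ * (P.gExt j (x + α n • v n) t - P.gExt j x t)) atTop
      (𝓝 (inner ℝ (gradient (fun y => P.gExt j y t) x) w)) := by
    intro j
    rw [inner_gradient_eq_fderiv]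
    refine (hreg.differentiable_gExt j t x).hasFDerivAt.hasFDerivWithinAt.lim (s := univ)
      hstep (Eventually.of_forall fun _ => mem_univ _) ?_
    refine hv.congr fun n => ?_
    rw [smul_smul, inv_mul_cancel₀ (hα n).ne', one_smul]
  rw [maxSubdiff_eq_sup']
  refine (Tendsto.finset_sup'_nhds_apply (activeSet_nonempty x t) fun j _ => hquot j).congr' ?_
  obtain ⟨j₀, hj₀⟩ := activeSet_nonempty (P := P) x t
  have hgt : ∀ j, Tendsto (fun n => P.gExt j (x + α n • v n) t) atTop (𝓝 (P.gExt j x t)) :=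
    fun j => ((hreg.differentiable_gExt j t).continuous.tendsto x).comp hy
  -- Indices inactive at `x` eventually stay below an active one, so the quotient of the maximum is
  -- the maximum of the active quotients.
  have hinact : ∀ᶠ n in atTop, ∀ j, j ∉ P.activeSet x t →
      P.gExt j (x + α n • v n) t < P.gExt j₀ (x + α n • v n) t := by
    refine eventually_all.2 fun j => ?_
    by_cases hj : j ∈ P.activeSet x t
    · simp [hj]
    have hlt : P.gExt j x t < P.gExt j₀ x t := by
      rw [← mem_activeSet.1 hj₀]
      exact (gExt_le_maxConstr j x t).lt_of_ne fun h => hj (mem_activeSet.2 h.symm)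
    filter_upwards [(hgt j).eventually_lt (hgt j₀) hlt] with n hn _ using hn
  filter_upwards [hinact] with n hn
  have hpos : 0 < (α n)⁻¹ := inv_pos.2 (hα n)
  refine le_antisymm (Finset.sup'_le _ _ fun j hj => ?_) ?_
  · refine mul_le_mul_of_nonneg_left ?_ hpos.le
    rw [mem_activeSet.1 hj]
    exact sub_le_sub_right (gExt_le_maxConstr _ _ _) _
  · obtain ⟨j, hj⟩ := exists_gExt_eq_maxConstr (P := P) (x + α n • v n) t
    have hjact : j ∈ P.activeSet x t := by
      by_contra hj'
      have := gExt_le_maxConstr (P := P) j₀ (x + α n • v n) t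
      linarith [hn j hj']
    rw [hj, mem_activeSet.1 hjact]
    exact Finset.le_sup' (fun j => (α n)⁻¹ * (P.gExt j (x + α n • v n) t - P.gExt j x t)) hjact

end DirectionalDerivative

/-! ### Decrease of the penalty term for finite `p`. -/

section FiniteExponent

theorem IsRegular.penaltyTerm_eq_integral_rpow (hreg : P.IsRegular) (hp1 : 1 < p) (hpt : p ≠ ∞)
    (x : P.Trajectory p) :
    penaltyTerm x =
      (∫ t, P.maxConstr (x.path t) t ^ p.toReal ∂lebesgue P.T) ^ p.toReal⁻¹ := by
  have hm := ((hreg.continuous_maxConstr_path x).memLp_lebesgue p).1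
  rw [penaltyTerm, toReal_eLpNorm hm,
    lpNorm_eq_integral_norm_rpow_toReal (zero_lt_one.trans hp1).ne' hpt hm]
  simp only [Real.norm_of_nonneg (maxConstr_nonneg _ _)]

theorem one_lt_toReal (hp1 : 1 < p) (hpt : p ≠ ∞) : 1 < p.toReal := by
  simpa using (ENNReal.toReal_lt_toReal ENNReal.one_ne_top hpt).2 hp1

theorem IsRegular.continuous_maxConstr_rpow (hreg : P.IsRegular) {s : ℝ} (hs : 0 ≤ s)
    (x : P.Trajectory p) : Continuous fun t => P.maxConstr (x.path t) t ^ s :=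
  (hreg.continuous_maxConstr_path x).rpow_const fun _ => Or.inr hs

theorem IsRegular.integral_rpow_mul_le (hreg : P.IsRegular) (hp1 : 1 < p) (hpt : p ≠ ∞)
    (x y : P.Trajectory p) :
    ∫ t, P.maxConstr (y.path t) t ^ (p.toReal - 1) * P.maxConstr (x.path t) t ∂lebesgue P.T ≤
      penaltyTerm y ^ (p.toReal - 1) * penaltyTerm x := by
  have hr := one_lt_toReal hp1 hpt
  have hc : (Real.conjExponent p.toReal).HolderConjugate p.toReal :=
    (Real.HolderConjugate.conjExponent hr).symm
  refine (integral_mul_le_Lp_mul_Lq_of_nonneg hc (Eventually.of_forall fun t =>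
    Real.rpow_nonneg (maxConstr_nonneg _ _) _) (Eventually.of_forall fun t => maxConstr_nonneg _ _)
    ((hreg.continuous_maxConstr_rpow (by linarith) y).memLp_lebesgue _)
    ((hreg.continuous_maxConstr_path x).memLp_lebesgue _)).trans (le_of_eq ?_)
  have hI : 0 ≤ ∫ t, P.maxConstr (y.path t) t ^ p.toReal ∂lebesgue P.T :=
    integral_nonneg fun t => Real.rpow_nonneg (maxConstr_nonneg _ _) _
  rw [hreg.penaltyTerm_eq_integral_rpow hp1 hpt, hreg.penaltyTerm_eq_integral_rpow hp1 hpt,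
    ← Real.rpow_mul hI, one_div, one_div]
  -- The conjugate exponent is `p / (p - 1)`, so the Hölder norm of the first factor is a power of
  -- the penalty term.
  have h1 : (p.toReal - 1) * Real.conjExponent p.toReal = p.toReal := by
    rw [Real.conjExponent, mul_div_cancel₀ _ (by linarith)]
  simp only [← Real.rpow_mul (maxConstr_nonneg _ _), h1]
  congr 2
  rw [Real.conjExponent]
  field_simp

theorem IsRegular.integral_rpow_mul_self (hreg : P.IsRegular) (hp1 : 1 < p) (hpt : p ≠ ∞)
    (x : P.Trajectory p) :
    ∫ t, P.maxConstr (x.path t) t ^ (p.toReal - 1) * P.maxConstr (x.path t) t ∂lebesgue P.T =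
      penaltyTerm x ^ (p.toReal - 1) * penaltyTerm x := by
  have hr := one_lt_toReal hp1 hpt
  have key : ∀ c : ℝ, 0 ≤ c → c ^ (p.toReal - 1) * c = c ^ p.toReal := fun c hc => by
    rw [← Real.rpow_add_one' hc (by linarith), sub_add_cancel]
  have hI : 0 ≤ ∫ t, P.maxConstr (x.path t) t ^ p.toReal ∂lebesgue P.T :=
    integral_nonneg fun t => Real.rpow_nonneg (maxConstr_nonneg _ _) _
  rw [key _ (penaltyTerm_nonneg x), hreg.penaltyTerm_eq_integral_rpow hp1 hpt,
    ← Real.rpow_mul hI, inv_mul_cancel₀ (by linarith), Real.rpow_one]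
  simp only [key _ (maxConstr_nonneg _ _)]

/-- The gradient inequality for the `L^p` norm at `y`. It follows from Hölder's inequality and its
equality case, so the norm never has to be differentiated. -/
theorem IsRegular.rpow_mul_penaltyTerm_sub_le (hreg : P.IsRegular) (hp1 : 1 < p) (hpt : p ≠ ∞)
    (x y : P.Trajectory p) :
    penaltyTerm y ^ (p.toReal - 1) * (penaltyTerm y - penaltyTerm x) ≤
      ∫ t, P.maxConstr (y.path t) t ^ (p.toReal - 1) *
        (P.maxConstr (y.path t) t - P.maxConstr (x.path t) t) ∂lebesgue P.T := by
  have hr := one_lt_toReal hp1 hpt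
  have hint : ∀ z : P.Trajectory p, Integrable (fun t => P.maxConstr (y.path t) t ^ (p.toReal - 1) *
      P.maxConstr (z.path t) t) (lebesgue P.T) := fun z =>
    memLp_one_iff_integrable.1 (((hreg.continuous_maxConstr_rpow (by linarith) y).mul
      (hreg.continuous_maxConstr_path z)).memLp_lebesgue 1)
  simp only [mul_sub]
  rw [integral_sub (hint y) (hint x), hreg.integral_rpow_mul_self hp1 hpt]
  linarith [hreg.integral_rpow_mul_le hp1 hpt x y]

/-- Convergence in `L^p` gives pointwise convergence only almost everywhere and along a subsequence.
The decrease is therefore claimed only frequently, which is enough to find one better trajectory. -/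
theorem IsRegular.frequently_penaltyTerm_le (hreg : P.IsRegular) (hc : IsCompact P.trajectorySet)
    [Fact (1 ≤ p)] (hp1 : 1 < p) (hpt : p ≠ ∞) {a : ℝ} (ha : 0 < a) {x : P.Trajectory p}
    (hx : x ∉ M P p) {xs : ℕ → P.Trajectory p} {h : P.Time → Vec d} (hne : ∀ n, xs n ≠ x)
    (hlim : Tendsto xs atTop (𝓝 x)) (hh : MemLp h p (lebesgue P.T))
    (hdir : Tendsto (fun n => eLpNorm
        (fun t => (lpDist (xs n) x)⁻¹ • ((xs n).path t - x.path t) - h t) p (lebesgue P.T))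
        atTop (𝓝 0)) (hdecr : DecreaseInequality a x h) :
    ∃ᶠ n in atTop, penaltyTerm (xs n) ≤ penaltyTerm x - a / 2 * lpDist (xs n) x := by
  have hr := one_lt_toReal hp1 hpt
  have hr0 : 0 ≤ p.toReal - 1 := by linarith
  set α : ℕ → ℝ := fun n => lpDist (xs n) x with hαdef
  have hα : ∀ n, 0 < α n := fun n => lpDist_pos (hne n)
  have hα0 : Tendsto α atTop (𝓝 0) :=
    squeeze_zero (fun n => (hα n).le) (fun n => lpDist_le_dist _ _) (tendsto_iff_dist_tendsto_zero.1 hlim)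
  set v : ℕ → P.Time → Vec d := fun n t => (α n)⁻¹ • ((xs n).path t - x.path t) with hvdef
  have hxs : ∀ n t, (xs n).path t = x.path t + α n • v n t := fun n t => by
    simp only [hvdef]
    rw [smul_smul, mul_inv_cancel₀ (hα n).ne', one_smul, add_sub_cancel]
  have hvc : ∀ n, Continuous (v n) := fun n => by
    simp only [hvdef]
    fun_prop
  have hp0 : p ≠ 0 := (zero_lt_one.trans hp1).ne'
  obtain ⟨ns, hns, hae⟩ := (tendstoInMeasure_of_tendsto_eLpNorm hp0
    (fun n => (hvc n).aestronglyMeasurable) hh.1 hdir).exists_seq_tendsto_ae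
  obtain ⟨R, hR⟩ := exists_path_mem_closedBall (p := p) hc
  obtain ⟨L, hL0, hL⟩ := hreg.exists_lipschitz_maxConstr R
  obtain ⟨B, hB⟩ := ((isCompact_closedBall (0 : Vec d) R).prod
    (isCompact_univ (X := P.Time))).exists_bound_of_continuousOn hreg.continuous_maxConstr.continuousOn
  -- The weight is taken at `xs n`, as in the gradient inequality; it converges to the weight at `x`
  -- in the hypothesis.
  set F : ℕ → P.Time → ℝ := fun n t => P.maxConstr ((xs n).path t) t ^ (p.toReal - 1) *
    ((α n)⁻¹ * (P.maxConstr ((xs n).path t) t - P.maxConstr (x.path t) t)) with hFdef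
  have hFc : ∀ n, Continuous (F n) := fun n =>
    (hreg.continuous_maxConstr_rpow hr0 _).mul (continuous_const.mul
      ((hreg.continuous_maxConstr_path _).sub (hreg.continuous_maxConstr_path _)))
  have hB0 : 0 ≤ B :=
    (norm_nonneg _).trans (hB (x.path P.final, P.final) ⟨hR x _, mem_univ _⟩)
  have hFb : ∀ n t, |F n t| ≤ B ^ (p.toReal - 1) * L * ‖v n t‖ := by
    intro n t
    have h1 : P.maxConstr ((xs n).path t) t ≤ B :=
      (le_abs_self _).trans (hB ((xs n).path t, t) ⟨hR _ _, mem_univ _⟩)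
    have h2 := hL t _ (hR (xs n) t) _ (hR x t)
    rw [hFdef, abs_mul, abs_mul, mul_assoc,
      abs_of_nonneg (Real.rpow_nonneg (maxConstr_nonneg _ _) _), abs_of_pos (inv_pos.2 (hα n))]
    refine mul_le_mul (Real.rpow_le_rpow (maxConstr_nonneg _ _) h1 hr0) ?_
      (mul_nonneg (inv_pos.2 (hα n)).le (abs_nonneg _)) (by positivity)
    have h3 : ‖v n t‖ = (α n)⁻¹ * ‖(xs n).path t - x.path t‖ := by
      rw [hvdef, norm_smul, Real.norm_of_nonneg (inv_pos.2 (hα n)).le]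
    rw [h3, mul_left_comm]
    exact mul_le_mul_of_nonneg_left h2 (inv_pos.2 (hα n)).le
  have hL1 : Tendsto (fun n => ∫ t, ‖v n t - h t‖ ∂lebesgue P.T) atTop (𝓝 0) := by
    obtain ⟨C, hC0, hC⟩ := exists_integral_norm_le_lpDist (P := P) (p := p) hp1.le
    have h1 := ((ENNReal.tendsto_toReal ENNReal.zero_ne_top).comp hdir).const_mul C
    rw [ENNReal.toReal_zero, mul_zero] at h1
    exact squeeze_zero (fun n => integral_nonneg fun t => norm_nonneg _)
      (fun n => hC _ (((hvc n).memLp_lebesgue p).sub hh)) h1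
  have hconv : Tendsto (fun k => ∫ t, F (ns k) t ∂lebesgue P.T) atTop
      (𝓝 (∫ t, P.maxConstr (x.path t) t ^ (p.toReal - 1) * P.maxSubdiff (x.path t) t (h t)
        ∂lebesgue P.T)) := by
    refine tendsto_integral_of_le_mul_norm (K := B ^ (p.toReal - 1) * L) (by positivity)
      (fun k => (hFc (ns k)).aestronglyMeasurable)
      (fun k => memLp_one_iff_integrable.1 ((hvc (ns k)).memLp_lebesgue 1))
      (hh.integrable hp1.le) (fun k t => hFb (ns k) t) (hL1.comp hns.tendsto_atTop) hae ?_
    filter_upwards [hae] with t ht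
    have h1 : Continuous fun y : P.Trajectory p => P.maxConstr (y.path t) t :=
      hreg.continuous_maxConstr.comp ((continuous_path_apply hc t).prodMk continuous_const)
    have h2 : Tendsto (fun k => P.maxConstr ((xs (ns k)).path t) t) atTop
        (𝓝 (P.maxConstr (x.path t) t)) :=
      (h1.tendsto x).comp (hlim.comp hns.tendsto_atTop)
    refine (h2.rpow_const (Or.inr hr0)).mul ?_
    refine (hreg.tendsto_maxConstr_quotient (x.path t) t (fun k => hα (ns k))
      (hα0.comp hns.tendsto_atTop) ht).congr fun k => ?_
    rw [← hxs]
  have hpen : Tendsto (fun k => penaltyTerm (xs (ns k))) atTop (𝓝 (penaltyTerm x)) :=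
    ((hreg.continuous_penaltyTerm hc).tendsto x).comp (hlim.comp hns.tendsto_atTop)
  have hx0 : 0 < penaltyTerm x :=
    (penaltyTerm_nonneg x).lt_of_ne fun h0 => hx ((hreg.penaltyTerm_eq_zero_iff x).1 h0.symm)
  -- Replacing `a` by `a / 2` makes the inequality between the limits strict, so it holds eventually
  -- along the subsequence.
  have hev := hconv.eventually_lt
    ((hpen.rpow_const (p := p.toReal - 1) (Or.inr hr0)).const_mul (-(a / 2))) (by
      have h1 := hdecr.1 hpt
      have h2 : 0 < a / 2 * penaltyTerm x ^ (p.toReal - 1) := by positivity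
      linarith)
  refine hns.tendsto_atTop.frequently (Eventually.frequently ?_)
  filter_upwards [hev, hpen.eventually_const_lt hx0] with k hk hk0
  have h1 := hreg.rpow_mul_penaltyTerm_sub_le hp1 hpt x (xs (ns k))
  have h2 : ∫ t, P.maxConstr ((xs (ns k)).path t) t ^ (p.toReal - 1) *
        (P.maxConstr ((xs (ns k)).path t) t - P.maxConstr (x.path t) t) ∂lebesgue P.T =
      α (ns k) * ∫ t, F (ns k) t ∂lebesgue P.T := by
    rw [← integral_const_mul]
    refine integral_congr_ae (Eventually.of_forall fun t => ?_)
    simp only [hFdef]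
    field_simp [(hα (ns k)).ne']
  have h3 : α (ns k) * ∫ t, F (ns k) t ∂lebesgue P.T ≤
      α (ns k) * (-(a / 2) * penaltyTerm (xs (ns k)) ^ (p.toReal - 1)) :=
    mul_le_mul_of_nonneg_left hk.le (hα _).le
  have h4 : penaltyTerm (xs (ns k)) ^ (p.toReal - 1) * (penaltyTerm (xs (ns k)) - penaltyTerm x) ≤
      penaltyTerm (xs (ns k)) ^ (p.toReal - 1) * (-(a / 2) * α (ns k)) := by
    linarith
  -- The common factor can be cancelled: by continuity the penalty term stays positive near the
  -- infeasible `x`.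
  have h5 := le_of_mul_le_mul_left h4 (Real.rpow_pos_of_pos hk0 _)
  linarith

end FiniteExponent
end ControlProblem
end ExactPenalty

/-! ### Decrease of the penalty term for `p = ∞`, and conclusion. -/

namespace ExactPenalty
namespace ControlProblem

variable {d m l : ℕ} {q : ℝ≥0∞} [Fact (1 ≤ q)] {P : ControlProblem d m l q} {p : ℝ≥0∞}

section InfiniteExponent

theorem _root_.Continuous.norm_le_toReal_eLpNorm_top_lebesgue {E : Type*} [NormedAddCommGroup E]
    [SecondCountableTopology E] {T : ℝ} (hT : 0 < T) {f : Icc (0 : ℝ) T → E} (hf : Continuous f)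
    (t : Icc (0 : ℝ) T) : ‖f t‖ ≤ (eLpNorm f ∞ (lebesgue T)).toReal := by
  have hm := hf.memLp_lebesgue ∞
  refine hf.norm.le_of_ae_le_lebesgue hT ?_ t
  rw [toReal_eLpNorm hm.1]
  exact ae_le_lpNorm_exponent_top hm

theorem IsRegular.maxConstr_le_penaltyTerm_top (hreg : P.IsRegular) (x : P.Trajectory ∞)
    (t : P.Time) : P.maxConstr (x.path t) t ≤ penaltyTerm x :=
  (le_abs_self _).trans
    ((hreg.continuous_maxConstr_path x).norm_le_toReal_eLpNorm_top_lebesgue P.T_pos t)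

theorem penaltyTerm_top_le {x : P.Trajectory ∞} {c : ℝ} (hc : 0 ≤ c)
    (h : ∀ t j, P.g j (x.path t) t ≤ c) : penaltyTerm x ≤ c := by
  refine ENNReal.toReal_le_of_le_ofReal hc ?_
  have h1 := eLpNorm_le_of_ae_bound (μ := lebesgue P.T) (p := ∞)
    (f := fun t => P.maxConstr (x.path t) t) (C := c) (Eventually.of_forall fun t => ?_)
  · simpa using h1
  rw [Real.norm_of_nonneg (maxConstr_nonneg _ _)]
  refine Finset.sup'_le _ _ fun j _ => ?_
  cases j with
  | none => exact hc
  | some j => exact h t j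

/-- If the constraint lies below `c` at `(y₀, t₀)`, continuity suffices. If it equals `c`, the slope
along `w` stays below `-b` nearby and the mean value theorem applies from the base point `y i`,
where the value is at most `c`. -/
theorem IsRegular.eventually_g_le (hreg : P.IsRegular) (j : Fin l) {b c : ℝ} {t₀ : P.Time}
    {y₀ w₀ : Vec d} (hval : P.g j y₀ t₀ ≤ c)
    (hgrad : c = P.g j y₀ t₀ → inner ℝ (gradient (fun y => P.g j y t₀) y₀) w₀ < -b)
    {ι : Type*} {F : Filter ι} {τ : ι → P.Time} {y w : ι → Vec d} {α : ι → ℝ}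
    (hα : ∀ i, 0 < α i) (hα0 : Tendsto α F (𝓝 0)) (hτ : Tendsto τ F (𝓝 t₀))
    (hy : Tendsto y F (𝓝 y₀)) (hw : Tendsto w F (𝓝 w₀))
    (hle : ∀ i, P.g j (y i) (τ i) ≤ c) :
    ∀ᶠ i in F, P.g j (y i + α i • w i) (τ i) ≤ c - b * α i := by
  have hy' : Tendsto (fun i => y i + α i • w i) F (𝓝 y₀) := by
    simpa using hy.add (hα0.smul hw)
  rcases hval.lt_or_eq with hlt | heq
  · have h1 : Tendsto (fun i => P.g j (y i + α i • w i) (τ i)) F (𝓝 (P.g j y₀ t₀)) :=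
      ((hreg.continuous_g j).tendsto (y₀, t₀)).comp (hy'.prodMk_nhds hτ)
    have h2 : Tendsto (fun i => c - b * α i) F (𝓝 c) := by
      simpa using (hα0.const_mul b).const_sub c
    exact (h1.eventually_lt h2 hlt).mono fun i hi => hi.le
  · have hcont : Continuous fun z : Vec d × P.Time × Vec d =>
        (inner ℝ (gradient (fun y => P.g j y z.2.1) z.1) z.2.2 : ℝ) :=
      ((hreg.continuous_grad_g j).comp (continuous_fst.prodMk continuous_snd.fst)).inner
        continuous_snd.snd
    have hnhds := (hcont.tendsto (y₀, t₀, w₀)).eventually_lt_const (hgrad heq.symm)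
    -- Separating the space variable gives a ball around `y₀`; being convex, it contains the mean
    -- value point `ξ`.
    rw [nhds_prod_eq, eventually_prod_iff] at hnhds
    obtain ⟨p₁, hp₁, p₂, hp₂, hp⟩ := hnhds
    obtain ⟨δ, hδ, hball⟩ := Metric.eventually_nhds_iff_ball.1 hp₁
    filter_upwards [hy.eventually (Metric.ball_mem_nhds y₀ hδ),
      hy'.eventually (Metric.ball_mem_nhds y₀ hδ), (hτ.prodMk_nhds hw).eventually hp₂]
      with i h1 h2 h3
    obtain ⟨ξ, hξ, hmv⟩ := domain_mvt (f := fun y => P.g j y (τ i))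
      (fun z _ => (hreg.differentiable_g j (τ i) z).hasFDerivAt.hasFDerivWithinAt)
      (convex_ball y₀ δ) h1 h2
    have hξ' : ξ ∈ Metric.ball y₀ δ := (convex_ball y₀ δ).segment_subset h1 h2 hξ
    have h4 := hp (hball ξ hξ') h3
    simp only at h4
    rw [add_sub_cancel_left, map_smul, ← inner_gradient_eq_fderiv, smul_eq_mul] at hmv
    have h5 := mul_lt_mul_of_pos_left h4 (hα i)
    linarith [hle i]

theorem IsRegular.eventually_penaltyTerm_top_le (hreg : P.IsRegular) {a : ℝ} (ha : 0 < a) {x : P.Trajectory ∞} (hx : x ∉ M P ∞)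
    {xs : ℕ → P.Trajectory ∞} {h : P.Time → Vec d} (hne : ∀ n, xs n ≠ x)
    (hlim : Tendsto xs atTop (𝓝 x))
    (hdir : Tendsto (fun n => eLpNorm
        (fun t => (lpDist (xs n) x)⁻¹ • ((xs n).path t - x.path t) - h t) ∞ (lebesgue P.T))
        atTop (𝓝 0)) (hdecr : DecreaseInequality a x h) :
    ∀ᶠ n in atTop, penaltyTerm (xs n) ≤ penaltyTerm x - a / 2 * lpDist (xs n) x := by
  obtain ⟨hhc, hgrad⟩ := hdecr.2 rfl
  set α : ℕ → ℝ := fun n => lpDist (xs n) x with hαdef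
  have hα : ∀ n, 0 < α n := fun n => lpDist_pos (hne n)
  have hα0 : Tendsto α atTop (𝓝 0) := squeeze_zero (fun n => (hα n).le)
    (fun n => lpDist_le_dist _ _) (tendsto_iff_dist_tendsto_zero.1 hlim)
  set v : ℕ → P.Time → Vec d := fun n t => (α n)⁻¹ • ((xs n).path t - x.path t) with hvdef
  have hxs : ∀ n t, (xs n).path t = x.path t + α n • v n t := fun n t => by
    simp only [hvdef]
    rw [smul_smul, mul_inv_cancel₀ (hα n).ne', one_smul, add_sub_cancel]
  have hvc : ∀ n, Continuous (v n) := fun n => by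
    simp only [hvdef]
    fun_prop
  have hunif : Tendsto (fun n => (eLpNorm (fun t => v n t - h t) ∞ (lebesgue P.T)).toReal) atTop
      (𝓝 0) := by
    simpa using! (ENNReal.tendsto_toReal ENNReal.zero_ne_top).comp hdir
  have hx0 : 0 < penaltyTerm x :=
    (penaltyTerm_nonneg x).lt_of_ne fun h0 => hx ((hreg.penaltyTerm_eq_zero_iff x).1 h0.symm)
  have hgx : ∀ t j, P.g j (x.path t) t ≤ penaltyTerm x := fun t j =>
    (gExt_le_maxConstr (some j) (x.path t) t).trans (hreg.maxConstr_le_penaltyTerm_top x t)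
  have hloc : ∀ t₀ : P.Time, ∀ j, ∀ᶠ z : ℕ × P.Time in atTop ×ˢ 𝓝 t₀,
      P.g j ((xs z.1).path z.2) z.2 ≤ penaltyTerm x - a / 2 * α z.1 := by
    intro t₀ j
    have hv0 : Tendsto (fun z : ℕ × P.Time => v z.1 z.2) (atTop ×ˢ 𝓝 t₀) (𝓝 (h t₀)) := by
      have h1 : Tendsto (fun z : ℕ × P.Time => v z.1 z.2 - h z.2) (atTop ×ˢ 𝓝 t₀) (𝓝 0) :=
        squeeze_zero_norm (fun z =>
          ((hvc z.1).sub hhc).norm_le_toReal_eLpNorm_top_lebesgue P.T_pos z.2)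
          (hunif.comp tendsto_fst)
      simpa using h1.add ((hhc.tendsto t₀).comp tendsto_snd)
    have h2 := hreg.eventually_g_le j (b := a / 2) (hgx t₀ j)
      (fun he => (hgrad t₀ j he).trans_lt (by linarith)) (F := atTop ×ˢ 𝓝 t₀) (τ := Prod.snd)
      (y := fun z => x.path z.2) (fun z => hα z.1) (hα0.comp tendsto_fst) tendsto_snd
      ((x.path.continuous.tendsto t₀).comp tendsto_snd) hv0 (fun z => hgx z.2 j)
    simpa only [← hxs] using h2
  have hall : ∀ᶠ n in atTop, ∀ t ∈ (univ : Set P.Time), ∀ j,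
      P.g j ((xs n).path t) t ≤ penaltyTerm x - a / 2 * α n := by
    -- Compactness of `[0, T]` joins the neighbourhoods of the single times, so that one threshold
    -- for `n` serves all times.
    have h1 : ∀ t ∈ (univ : Set P.Time), ∀ᶠ z : ℕ × P.Time in atTop ×ˢ 𝓝 t, ∀ j,
        P.g j ((xs z.1).path z.2) z.2 ≤ penaltyTerm x - a / 2 * α z.1 :=
      fun t _ => eventually_all.2 fun j => hloc t j
    simp only [← eventually_iSup, ← isCompact_univ.prod_nhdsSet_eq_biSup] at h1
    exact h1.curry.mono fun _ h => h.self_of_nhdsSet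
  have hpos : ∀ᶠ n in atTop, 0 < penaltyTerm x - a / 2 * α n := by
    have : Tendsto (fun n => penaltyTerm x - a / 2 * α n) atTop (𝓝 (penaltyTerm x)) := by
      simpa using (hα0.const_mul (a / 2)).const_sub (penaltyTerm x)
    exact this.eventually_const_lt hx0
  filter_upwards [hall, hpos] with n hn hn0
  exact penaltyTerm_top_le hn0.le fun t j => hn t (mem_univ t) j

end InfiniteExponent

theorem UniformDecrease.exists_penaltyTerm_le [Fact (1 ≤ p)] (hreg : P.IsRegular)
    (hc : IsCompact P.trajectorySet) (hp1 : 1 < p) (hdecr : UniformDecrease P p) :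
    ∃ b > 0, ∀ x ∈ A P p, x ∉ M P p → ∀ δ > 0, ∃ y ∈ A P p, 0 < dist y x ∧ dist y x < δ ∧
      penaltyTerm y ≤ penaltyTerm x - b * dist y x := by
  obtain ⟨a, ha, η, hη, H⟩ := hdecr
  -- The endpoint bound gives `d_X ≤ (1 + η) ‖·‖_p` along the sequence, which costs the factor `1 +
  -- η` in the slope.
  refine ⟨a / 2 / (1 + η), by positivity, fun x hx hxM δ hδ => ?_⟩
  obtain ⟨xs, h, hA, hne, hlim, hend, hh, hdir, hD⟩ := H x ⟨hx, fun hΩ => hxM hΩ.1⟩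
  have hfreq : ∃ᶠ n in atTop, penaltyTerm (xs n) ≤ penaltyTerm x - a / 2 * lpDist (xs n) x := by
    by_cases hpt : p = ∞
    · subst hpt
      exact (hreg.eventually_penaltyTerm_top_le ha hxM hne hlim hdir hD).frequently
    · exact hreg.frequently_penaltyTerm_le hc hp1 hpt ha hxM hne hlim hh hdir hD
  obtain ⟨n, hn, hnδ⟩ := (hfreq.and_eventually (hlim.eventually (Metric.ball_mem_nhds x hδ))).exists
  refine ⟨xs n, hA n, dist_pos.2 (hne n), hnδ, hn.trans (sub_le_sub_left ?_ _)⟩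
  have h1 : dist (xs n) x ≤ (1 + η) * lpDist (xs n) x := by
    rw [dist_def]
    linarith [hend n]
  rw [div_mul_eq_mul_div, div_le_iff₀ (by positivity)]
  have h2 := mul_le_mul_of_nonneg_left h1 (by positivity : 0 ≤ a / 2)
  linarith

end ControlProblem
end ExactPenalty

open ExactPenalty.ControlProblem in
theorem mainTheorem7 {d m l : ℕ} (p q : ENNReal) [Fact (1 ≤ p)] [Fact (1 ≤ q)] (hp : 1 < p)
    (P : ExactPenalty.ControlProblem d m l q)
    (hreg : P.IsRegular)
    (hcompact : IsCompact P.trajectorySet)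
    (hfeas : (ExactPenalty.ControlProblem.Ω P p).Nonempty)
    (hdecr : ExactPenalty.ControlProblem.UniformDecrease P p) :
    ExactPenalty.IsCompletelyExactOn
      (ExactPenalty.ControlProblem.cost : P.Trajectory p → ℝ)
      (ExactPenalty.ControlProblem.penaltyTerm : P.Trajectory p → ℝ)
      (ExactPenalty.ControlProblem.M P p)
      (ExactPenalty.ControlProblem.A P p) := by
  have := compactSpace_trajectory (p := p) hcompact
  obtain ⟨L, hL0, hL⟩ := hreg.exists_lipschitz_cost (p := p) hcompact
  obtain ⟨b, hb, hdec⟩ := hdecr.exists_penaltyTerm_le hreg hcompact hp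
  exact ExactPenalty.isCompletelyExactOn_of_decrease (isClosed_A hcompact).isCompact
    (hreg.continuous_penaltyTerm hcompact) penaltyTerm_nonneg hreg.penaltyTerm_eq_zero_iff hb hL0
    hL hdec
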